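/- A \emph{semiring} $(S,+,\cdot)$ is a nonempty set with two associative operations such that $\cdot$ distributes over $+$ on both sides (addition need not be commutative, and no zero or identity is required); rings are associative and need not have an identity. A semiring is \emph{idempotent} if $x+x=x=x\cdot x$ for all $x$. On an idempotent semiring put \[ a\,\mathcal D^+\,b \iff a+b+a=a,\ b+a+b=b;\qquad a\,\mathcal L^+\,b \iff a+b=a,\ b+a=b;\qquad a\,\mathcal R^+\,b \iff a+b=b,\ b+a=a. \] An idempotent semiring is called a \emph{band semiring} [\emph{left band semiring}, \emph{right band semiring}] if $\mathcal D^+$ [$\mathcal L^+$, $\mathcal R^+$] is its least distributive lattice congruence. A semiring is \emph{completely regular} if it is a union of subsemirings that are rings. A completely regular semiring $S$ is a \emph{band orthoring} [\emph{left band orthoring}, \emph{right band orthoring}] if the set $E^+(S)=\{e\in S: e+e=e\}$ is a subsemiring of $S$ and is a band semiring [left band semiring, right band semiring]. Regard completely regular semirings as algebras $(S,+,\cdot,{}')$ of type $(2,2,1)$, where $x'$ is the inverse of $x$ in the maximal subgroup of $(S,+)$ containing $x$ (equivalently, $x+x'+x=x$, $x+x'=x'+x$, $(x')'=x$ for all $x$).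 A \emph{variety} is a class of algebras of this type defined by a set of identities, and the \emph{join} $\mathbf V\vee\mathbf W$ of two varieties is the least variety containing both. \textbf{Theorem.} The classes $\mathbf{BOR}$, $\mathbf{LBOR}$, $\mathbf{RBOR}$ of all band orthorings, all left band orthorings and all right band orthorings are varieties, and \[ \mathbf{BOR}=\mathbf{LBOR}\vee\mathbf{RBOR}. \] -/

import Mathlib

universe u

namespace BandOrthoring

/-! ### Semirings (addition need not be commutative, no zero and no one) -/

/-- `(S, +, ·)` is a semiring: both reducts are semigroups and multiplication distributes over
addition on both sides. -/
structure IsSemiring (S : Type u) [Add S] [Mul S] : Prop where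
  add_assoc : ∀ x y z : S, (x + y) + z = x + (y + z)
  mul_assoc : ∀ x y z : S, (x * y) * z = x * (y * z)
  left_distrib : ∀ x y z : S, x * (y + z) = x * y + x * z
  right_distrib : ∀ x y z : S, (x + y) * z = x * z + y * z

/-- A subset closed under both operations; it carries the restricted operations. -/
structure Subsemiring (S : Type u) [Add S] [Mul S] where
  carrier : Set S
  add_mem : ∀ x ∈ carrier, ∀ y ∈ carrier, x + y ∈ carrier
  mul_mem : ∀ x ∈ carrier, ∀ y ∈ carrier, x * y ∈ carrier

namespace Subsemiring

variable {S : Type u} [Add S] [Mul S]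

/-- The elements of a subsemiring, as a type. -/
def Elem (T : Subsemiring S) : Type u := {x : S // x ∈ T.carrier}

instance (T : Subsemiring S) : Add T.Elem :=
  ⟨fun x y => ⟨x.1 + y.1, T.add_mem x.1 x.2 y.1 y.2⟩⟩

instance (T : Subsemiring S) : Mul T.Elem :=
  ⟨fun x y => ⟨x.1 * y.1, T.mul_mem x.1 x.2 y.1 y.2⟩⟩

end Subsemiring

/-- `(R, +, ·)` is an associative ring, not necessarily with an identity. -/
structure IsRing (R : Type u) [Add R] [Mul R] : Prop extends IsSemiring R where
  add_comm : ∀ x y : R, x + y = y + x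
  exists_zero_neg : ∃ z : R, (∀ x : R, z + x = x) ∧ ∀ x : R, ∃ y : R, x + y = z

/-- A completely regular semiring: a semiring which is a union of rings (subsemirings that are
rings under the restricted operations). -/
structure IsCompletelyRegular (S : Type u) [Add S] [Mul S] : Prop extends IsSemiring S where
  union_of_rings : ∀ x : S, ∃ R : Subsemiring S, x ∈ R.carrier ∧ IsRing R.Elem

/-! ### Idempotent semirings and band semirings -/

/-- An idempotent semiring: both reducts are bands. -/
structure IsIdempotentSemiring (S : Type u) [Add S] [Mul S] : Prop extends IsSemiring S where
  add_self : ∀ x : S, x + x = x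
  mul_self : ∀ x : S, x * x = x

/-- A semiring whose operations are the join and the meet of a distributive lattice. -/
structure IsDistributiveLattice (S : Type u) [Add S] [Mul S] : Prop
    extends IsIdempotentSemiring S where
  add_comm : ∀ x y : S, x + y = y + x
  mul_comm : ∀ x y : S, x * y = y * x
  add_absorb : ∀ x y : S, x + x * y = x
  mul_absorb : ∀ x y : S, x * (x + y) = x

/-- Green's relation `𝓓⁺` of the additive reduct of an idempotent semiring. -/
def DPlus {S : Type u} [Add S] (a b : S) : Prop := a + b + a = a ∧ b + a + b = b

/-- Green's relation `𝓛⁺` of the additive reduct of an idempotent semiring. -/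
def LPlus {S : Type u} [Add S] (a b : S) : Prop := a + b = a ∧ b + a = b

/-- Green's relation `𝓡⁺` of the additive reduct of an idempotent semiring. -/
def RPlus {S : Type u} [Add S] (a b : S) : Prop := a + b = b ∧ b + a = a

/-- The relation `r` is the least distributive lattice congruence on `S`. A `RingCon` is an
equivalence relation compatible with `+` and `*`. -/
def IsLeastDistributiveLatticeCongruence (S : Type u) [Add S] [Mul S] (r : S → S → Prop) : Prop :=
  ∃ c : RingCon S, (∀ a b : S, c a b ↔ r a b) ∧
    IsLeast {d : RingCon S | IsDistributiveLattice d.Quotient} c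

/-- A band semiring: an idempotent semiring on which `𝓓⁺` is the least distributive lattice
congruence. -/
def IsBandSemiring (S : Type u) [Add S] [Mul S] : Prop :=
  IsIdempotentSemiring S ∧ IsLeastDistributiveLatticeCongruence S DPlus

/-- A left band semiring: an idempotent semiring on which `𝓛⁺` is the least distributive lattice
congruence. -/
def IsLeftBandSemiring (S : Type u) [Add S] [Mul S] : Prop :=
  IsIdempotentSemiring S ∧ IsLeastDistributiveLatticeCongruence S LPlus

/-- A right band semiring: an idempotent semiring on which `𝓡⁺` is the least distributive lattice
congruence. -/
def IsRightBandSemiring (S : Type u) [Add S] [Mul S] : Prop :=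
  IsIdempotentSemiring S ∧ IsLeastDistributiveLatticeCongruence S RPlus

/-! ### Band orthorings -/

/-- The set `E⁺(S)` of additive idempotents. -/
def addIdempotents (S : Type u) [Add S] : Set S := {e | e + e = e}

/-- A band orthoring: a completely regular semiring `S` such that `E⁺(S)` is a subsemiring and is
a band semiring. -/
def IsBandOrthoring (S : Type u) [Add S] [Mul S] : Prop :=
  IsCompletelyRegular S ∧
    ∃ T : Subsemiring S, T.carrier = addIdempotents S ∧ IsBandSemiring T.Elem

/-- A left band orthoring: `E⁺(S)` is a left band semiring. -/
def IsLeftBandOrthoring (S : Type u) [Add S] [Mul S] : Prop :=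
  IsCompletelyRegular S ∧
    ∃ T : Subsemiring S, T.carrier = addIdempotents S ∧ IsLeftBandSemiring T.Elem

/-- A right band orthoring: `E⁺(S)` is a right band semiring. -/
def IsRightBandOrthoring (S : Type u) [Add S] [Mul S] : Prop :=
  IsCompletelyRegular S ∧
    ∃ T : Subsemiring S, T.carrier = addIdempotents S ∧ IsRightBandSemiring T.Elem

/-! ### Varieties of algebras of type `(2, 2, 1)` -/

/-- A nonempty algebra `(S, +, ·, ')` of type `(2, 2, 1)`, with no laws imposed. The unary
operation is written `-`. -/
structure Alg : Type (u + 1) where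
  carrier : Type u
  [nonempty : Nonempty carrier]
  [add : Add carrier]
  [mul : Mul carrier]
  [neg : Neg carrier]

attribute [instance] Alg.nonempty Alg.add Alg.mul Alg.neg

/-- Terms of type `(2, 2, 1)` in countably many variables. -/
inductive Term : Type
  | var : ℕ → Term
  | add : Term → Term → Term
  | mul : Term → Term → Term
  | neg : Term → Term

/-- The value of a term under an assignment of the variables. -/
def Term.eval {S : Type u} [Add S] [Mul S] [Neg S] (v : ℕ → S) : Term → S
  | .var n => v n
  | .add s t => s.eval v + t.eval v
  | .mul s t => s.eval v * t.eval v
  | .neg t => -t.eval v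

/-- The algebra `A` satisfies the identity `p.1 ≈ p.2`. -/
def Satisfies (A : Alg.{u}) (p : Term × Term) : Prop :=
  ∀ v : ℕ → A.carrier, p.1.eval v = p.2.eval v

/-- A variety: a class of algebras defined by a set of identities. -/
def IsVariety (K : Set Alg.{u}) : Prop :=
  ∃ E : Set (Term × Term), K = {A | ∀ p ∈ E, Satisfies A p}

/-- The join of two classes in the lattice of varieties: the intersection of all varieties
containing both of them. -/
def varietyJoin (K L : Set Alg.{u}) : Set Alg.{u} :=
  ⋂₀ {V | IsVariety V ∧ K ⊆ V ∧ L ⊆ V}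

/-- In a completely regular semiring these laws say that `-x` is the inverse of `x` in the
maximal subgroup of `(S, +)` containing `x`. -/
structure IsInverseOperation (S : Type u) [Add S] [Neg S] : Prop where
  add_neg_add : ∀ x : S, x + -x + x = x
  add_neg_comm : ∀ x : S, x + -x = -x + x
  neg_neg : ∀ x : S, -(-x) = x

/-- The class of band orthorings, as algebras `(S, +, ·, ')`. -/
def BOR : Set Alg.{u} :=
  {A | IsBandOrthoring A.carrier ∧ IsInverseOperation A.carrier}

/-- The class of left band orthorings, as algebras `(S, +, ·, ')`. -/
def LBOR : Set Alg.{u} :=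
  {A | IsLeftBandOrthoring A.carrier ∧ IsInverseOperation A.carrier}

/-- The class of right band orthorings, as algebras `(S, +, ·, ')`. -/
def RBOR : Set Alg.{u} :=
  {A | IsRightBandOrthoring A.carrier ∧ IsInverseOperation A.carrier}

end BandOrthoring

/-!
A semiring is a band orthoring when the idempotents `x⁰ = x + x'` satisfy the identities of band
semirings and all terms in one variable commute under addition, so that every element generates a
ring. In a band semiring, multiplying `e` by an element `k` that is `𝓙⁺`-below it stays in the
`𝓓⁺`-class of `e`, which is a rectangular band. Hence, if `e 𝓡⁺ f`, expanding `(e + k) * (f + k)` in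
two ways gives `e + k = f + k`, which makes `𝓡⁺` (and dually `𝓛⁺`) an additive congruence.
Consequently `a = b + a⁰, b = a + b⁰` defines a congruence on a band orthoring, whose quotient is a
left band orthoring; its dual gives a right band orthoring, and the two congruences intersect in
equality. So a band orthoring is a subdirect product of a left and a right one, and satisfies every
identity that holds in both.
-/

namespace BandOrthoring

section AddBand

/-- A band, written additively: an idempotent semigroup. -/
structure IsAddBand (S : Type u) [Add S] : Prop where
  add_assoc : ∀ x y z : S, (x + y) + z = x + (y + z)
  add_self : ∀ x : S, x + x = x

variable {S : Type u} [Add S]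

/-- The preorder of Green's relation `𝓙⁺` on a band: `a` lies in the two-sided ideal generated by
`b`. As `𝓙⁺ = 𝓓⁺`, two elements are `𝓓⁺`-related when each lies below the other. -/
def JLe (a b : S) : Prop := a + b + a = a

namespace IsAddBand

theorem jle_refl (h : IsAddBand S) (a : S) : JLe a a := by
  rw [JLe, h.add_self, h.add_self]

theorem jle_of_eq_add_add (h : IsAddBand S) {a b u v : S} (ha : a = u + b + v) : JLe a b := by
  have absorb : a + b + v = a := by
    rw [ha, h.add_assoc u b v, h.add_assoc, h.add_assoc u, h.add_self]
  calc a + b + a = a + b + (a + b + v) := by rw [absorb]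
    _ = a + b + (a + b) + v := (h.add_assoc _ _ _).symm
    _ = a := by rw [h.add_self, absorb]

theorem jle_trans (h : IsAddBand S) {a b c : S} (hab : JLe a b) (hbc : JLe b c) : JLe a c := by
  refine h.jle_of_eq_add_add (u := a + b) (v := b + a) ?_
  calc a = a + (b + c + b) + a := by rw [hbc, hab]
    _ = a + b + c + (b + a) := by simp only [h.add_assoc]

theorem add_jle_left (h : IsAddBand S) (a b : S) : JLe (a + b) a :=
  h.jle_of_eq_add_add (u := a) (v := b) (by rw [h.add_self])

theorem add_jle_right (h : IsAddBand S) (a b : S) : JLe (a + b) b :=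
  h.jle_of_eq_add_add (u := a) (v := b) (by rw [h.add_assoc, h.add_self])

theorem add_jle_add_comm (h : IsAddBand S) (a b : S) : JLe (a + b) (b + a) := by
  refine h.jle_of_eq_add_add (u := a) (v := b) ?_
  rw [← h.add_assoc, h.add_assoc, h.add_self]

theorem jle_add (h : IsAddBand S) {a b c : S} (hb : JLe a b) (hc : JLe a c) : JLe a (b + c) := by
  have below_bac : JLe a (b + (a + c)) := by
    refine h.jle_of_eq_add_add (u := a) (v := a) ?_
    calc a = a + b + (a + c + a) := by rw [hc, hb]
      _ = a + (b + (a + c)) + a := by simp only [h.add_assoc]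
  have bac_below_cb : JLe (b + (a + c)) (c + b) := by
    refine h.jle_trans (h.add_jle_add_comm b (a + c)) ?_
    rw [h.add_assoc]
    exact h.add_jle_right a (c + b)
  exact h.jle_trans below_bac (h.jle_trans bac_below_cb (h.add_jle_add_comm c b))

theorem add_jle_add (h : IsAddBand S) {a b c d : S} (hab : JLe a b) (hcd : JLe c d) :
    JLe (a + c) (b + d) :=
  h.jle_add (h.jle_trans (h.add_jle_left a c) hab) (h.jle_trans (h.add_jle_right a c) hcd)

theorem dplus_refl (h : IsAddBand S) (a : S) : DPlus a a :=
  ⟨h.jle_refl a, h.jle_refl a⟩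

theorem dplus_trans (h : IsAddBand S) {a b c : S} (hab : DPlus a b) (hbc : DPlus b c) :
    DPlus a c :=
  ⟨h.jle_trans hab.1 hbc.1, h.jle_trans hbc.2 hab.2⟩

theorem dplus_add_comm (h : IsAddBand S) (a b : S) : DPlus (a + b) (b + a) :=
  ⟨h.add_jle_add_comm a b, h.add_jle_add_comm b a⟩

/-- Each `𝓓⁺`-class is a rectangular band. -/
theorem add_add_eq_add_of_dplus (h : IsAddBand S) {p t q : S} (hpt : DPlus p t)
    (hpq : DPlus p q) : p + t + q = p + q := by
  have q_below : JLe q (p + t) := h.jle_add hpq.2 (h.jle_trans hpq.2 hpt.1)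
  calc p + t + q = p + q + p + t + q := by rw [hpq.1]
    _ = p + (q + (p + t) + q) := by simp only [h.add_assoc]
    _ = p + q := by rw [q_below]

end IsAddBand

theorem lplus_eq_dplus (h : ∀ a b : S, a + b + a = a + b) : LPlus (S := S) = DPlus := by
  funext a b
  simp only [LPlus, DPlus, h]

theorem rplus_eq_dplus (h : ∀ a b : S, a + b + a = b + a) : RPlus (S := S) = DPlus := by
  funext a b
  simp only [RPlus, DPlus, h, and_comm]

theorem dplus_of_rplus {a b : S} (hab : RPlus a b) : DPlus a b :=
  ⟨by rw [hab.1, hab.2], by rw [hab.2, hab.1]⟩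

end AddBand

section BandSemiring

variable {S : Type u} [Add S] [Mul S]

theorem IsSemiring.quotient (h : IsSemiring S) (c : RingCon S) : IsSemiring c.Quotient where
  add_assoc := by rintro ⟨x⟩ ⟨y⟩ ⟨z⟩; exact congrArg _ (h.add_assoc x y z)
  mul_assoc := by rintro ⟨x⟩ ⟨y⟩ ⟨z⟩; exact congrArg _ (h.mul_assoc x y z)
  left_distrib := by rintro ⟨x⟩ ⟨y⟩ ⟨z⟩; exact congrArg _ (h.left_distrib x y z)
  right_distrib := by rintro ⟨x⟩ ⟨y⟩ ⟨z⟩; exact congrArg _ (h.right_distrib x y z)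

namespace IsIdempotentSemiring

theorem quotient (h : IsIdempotentSemiring S) (c : RingCon S) :
    IsIdempotentSemiring c.Quotient where
  toIsSemiring := h.toIsSemiring.quotient c
  add_self := by rintro ⟨x⟩; exact congrArg _ (h.add_self x)
  mul_self := by rintro ⟨x⟩; exact congrArg _ (h.mul_self x)

theorem isAddBand (h : IsIdempotentSemiring S) : IsAddBand S := { h with }

theorem mul_jle_mul (h : IsIdempotentSemiring S) {a b c d : S} (hab : JLe a b) (hcd : JLe c d) :
    JLe (a * c) (b * d) := by
  refine h.isAddBand.jle_trans (b := b * c) ?_ ?_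
  · rw [JLe, ← h.right_distrib, ← h.right_distrib, hab]
  · rw [JLe, ← h.left_distrib, ← h.left_distrib, hcd]

/-- Green's relation `𝓓⁺` of an idempotent semiring, as a congruence. -/
def dplusCon (h : IsIdempotentSemiring S) : RingCon S where
  r := DPlus
  iseqv := ⟨h.isAddBand.dplus_refl, And.symm, h.isAddBand.dplus_trans⟩
  add' hab hcd := ⟨h.isAddBand.add_jle_add hab.1 hcd.1, h.isAddBand.add_jle_add hab.2 hcd.2⟩
  mul' hab hcd := ⟨h.mul_jle_mul hab.1 hcd.1, h.mul_jle_mul hab.2 hcd.2⟩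

end IsIdempotentSemiring

theorem rel_of_dplus {d : RingCon S} (hd : IsDistributiveLattice d.Quotient) {a b : S}
    (hab : DPlus a b) : d a b := by
  have add_eq_left : ∀ {x y : S}, x + y + x = x → (x : d.Quotient) + y = x := by
    intro x y hxy
    have hq : (x : d.Quotient) + y + x = x := congrArg _ hxy
    rwa [hd.add_comm, ← hd.add_assoc, hd.add_self] at hq
  refine d.eq.1 ?_
  calc (a : d.Quotient) = a + b := (add_eq_left hab.1).symm
    _ = b + a := hd.add_comm _ _
    _ = b := add_eq_left hab.2

namespace IsLeastDistributiveLatticeCongruence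

variable {r : S → S → Prop}

theorem rel_add_comm (h : IsLeastDistributiveLatticeCongruence S r) (a b : S) :
    r (a + b) (b + a) := by
  obtain ⟨c, hc, hd, -⟩ := h
  exact (hc _ _).1 (c.eq.1 (IsDistributiveLattice.add_comm hd a b))

theorem rel_add_mul (h : IsLeastDistributiveLatticeCongruence S r) (a b : S) :
    r (a + a * b) a := by
  obtain ⟨c, hc, hd, -⟩ := h
  exact (hc _ _).1 (c.eq.1 (IsDistributiveLattice.add_absorb hd a b))

theorem rel_add_mul_comm (h : IsLeastDistributiveLatticeCongruence S r) (a b : S) :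
    r (a + b * a) a := by
  obtain ⟨c, hc, hd, -⟩ := h
  have absorb := IsDistributiveLattice.add_absorb hd (a : c.Quotient) b
  rw [IsDistributiveLattice.mul_comm hd] at absorb
  exact (hc _ _).1 (c.eq.1 absorb)

end IsLeastDistributiveLatticeCongruence

/-- The identities defining band semirings among idempotent semirings: `x` lies `𝓙⁺`-below all its
multiples. -/
structure BandSemiringLaws (S : Type u) [Add S] [Mul S] : Prop
    extends IsIdempotentSemiring S where
  jle_mul_right : ∀ x y : S, x + x * y + x = x
  jle_mul_left : ∀ x y : S, x + y * x + x = x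

namespace BandSemiringLaws

theorem mul_jle_mul_comm (h : BandSemiringLaws S) (a b : S) : JLe (a * b) (b * a) := by
  have below := h.isAddBand.jle_trans (h.jle_mul_right (a * b) a) (h.jle_mul_left (a * b * a) b)
  rwa [h.mul_assoc a b a, ← h.mul_assoc b, h.mul_self] at below

theorem dplus_add_mul (h : BandSemiringLaws S) (a b : S) : DPlus (a + a * b) a :=
  ⟨h.isAddBand.add_jle_left a (a * b),
    h.isAddBand.jle_add (h.isAddBand.jle_refl a) (h.jle_mul_right a b)⟩

theorem isDistributiveLattice_quotient (h : BandSemiringLaws S) :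
    IsDistributiveLattice h.dplusCon.Quotient where
  toIsIdempotentSemiring := h.toIsIdempotentSemiring.quotient _
  add_comm := by
    rintro ⟨x⟩ ⟨y⟩
    exact h.dplusCon.eq.2 (h.isAddBand.dplus_add_comm x y)
  mul_comm := by
    rintro ⟨x⟩ ⟨y⟩
    exact h.dplusCon.eq.2 ⟨h.mul_jle_mul_comm x y, h.mul_jle_mul_comm y x⟩
  add_absorb := by
    rintro ⟨x⟩ ⟨y⟩
    exact h.dplusCon.eq.2 (h.dplus_add_mul x y)
  mul_absorb := by
    rintro ⟨x⟩ ⟨y⟩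
    refine (h.dplusCon.eq (a := x * (x + y)) (b := x)).2 ?_
    change DPlus (x * (x + y)) x
    rw [h.left_distrib, h.mul_self]
    exact h.dplus_add_mul x y

theorem dplus_mul_right (h : BandSemiringLaws S) {x k : S} (hk : JLe k x) : DPlus x (x * k) := by
  refine ⟨h.jle_mul_right x k, ?_⟩
  have below := h.mul_jle_mul (h.isAddBand.jle_refl x) hk
  rwa [h.mul_self] at below

theorem dplus_mul_left (h : BandSemiringLaws S) {x k : S} (hk : JLe k x) : DPlus x (k * x) := by
  refine ⟨h.jle_mul_left x k, ?_⟩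
  have below := h.mul_jle_mul hk (h.isAddBand.jle_refl x)
  rwa [h.mul_self] at below

/-- The elements `e`, `f`, `e * f`, `e * k`, `k * f` all lie in one rectangular band, so the two
ways of expanding `(e + k) * (f + k)` collapse to different three-term sums. -/
theorem add_eq_add_of_rplus (h : BandSemiringLaws S) {e f k : S} (hef : RPlus e f)
    (hk : JLe k e) : e + k = f + k := by
  have hb := h.isAddBand
  have d_ef := dplus_of_rplus hef
  have hkf : JLe k f := hb.jle_trans hk d_ef.1
  have rect : ∀ {p t q : S}, DPlus e p → DPlus e t → DPlus e q → p + t + q = p + q :=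
    fun hp ht hq =>
      hb.add_add_eq_add_of_dplus (hb.dplus_trans hp.symm ht) (hb.dplus_trans hp.symm hq)
  have d_ee := hb.dplus_refl e
  have d_ek : DPlus e (e * k) := h.dplus_mul_right hk
  have d_ke : DPlus e (k * e) := h.dplus_mul_left hk
  have d_fk : DPlus e (f * k) := hb.dplus_trans d_ef (h.dplus_mul_right hkf)
  have d_kf : DPlus e (k * f) := hb.dplus_trans d_ef (h.dplus_mul_left hkf)
  have r_mul : RPlus e (e * f) := by
    have absorb₁ := h.left_distrib e e f
    have absorb₂ := h.left_distrib e f e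
    rw [hef.1, h.mul_self] at absorb₁
    rw [hef.2, h.mul_self] at absorb₂
    exact ⟨absorb₁.symm, absorb₂.symm⟩
  have d_mul := dplus_of_rplus r_mul
  have expand : ∀ x y : S, (x + k) * (y + k) = x * y + k * y + x * k + k := fun x y => by
    rw [h.left_distrib, h.right_distrib, h.right_distrib, h.mul_self, ← h.add_assoc]
  have expand' : ∀ x y : S, (x + k) * (y + k) = x * y + x * k + k * y + k := fun x y => by
    rw [h.right_distrib, h.left_distrib, h.left_distrib, h.mul_self, ← h.add_assoc]
  have f_add : e * f + f = f := by
    calc e * f + f = e * f + (e + f) := by rw [hef.1]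
      _ = f := by rw [← h.add_assoc, r_mul.2, hef.1]
  calc e + k = (e + k) * (e + k) := (h.mul_self _).symm
    _ = e + e * k + k := by rw [expand, h.mul_self, rect d_ee d_ke d_ek]
    _ = e * f + e * k + k := by rw [← rect d_ee d_mul d_ek, r_mul.1]
    _ = (e + k) * (f + k) := by rw [expand, rect d_mul d_kf d_ek]
    _ = e * f + k * f + k := by rw [expand', rect d_mul d_ek d_kf]
    _ = f + k * f + k := by rw [← rect d_mul d_ef d_kf, f_add]
    _ = (f + k) * (f + k) := by rw [expand', h.mul_self, rect d_ef d_fk d_kf]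
    _ = f + k := h.mul_self _

end BandSemiringLaws

theorem isBandSemiring_iff : IsBandSemiring S ↔ BandSemiringLaws S := by
  constructor
  · rintro ⟨h, hleast⟩
    have jle_of_add : ∀ {x y : S}, DPlus (x + y) x → JLe x y := fun {x y} hxy =>
      h.isAddBand.jle_trans hxy.2 (h.isAddBand.add_jle_right x y)
    exact
      { h with
        jle_mul_right := fun x y => jle_of_add (hleast.rel_add_mul x y)
        jle_mul_left := fun x y => jle_of_add (hleast.rel_add_mul_comm x y) }
  · intro h
    exact ⟨h.toIsIdempotentSemiring, h.dplusCon, fun _ _ => Iff.rfl,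
      h.isDistributiveLattice_quotient, fun _ hd _ _ hab => rel_of_dplus hd hab⟩

theorem isLeftBandSemiring_iff :
    IsLeftBandSemiring S ↔ IsBandSemiring S ∧ ∀ a b : S, a + b + a = a + b := by
  constructor
  · rintro ⟨h, hleast⟩
    have left : ∀ a b : S, a + b + a = a + b := fun a b => by
      have rel := (hleast.rel_add_comm a b).1
      rwa [← h.add_assoc, h.add_assoc a b b, h.add_self] at rel
    exact ⟨⟨h, lplus_eq_dplus left ▸ hleast⟩, left⟩
  · rintro ⟨⟨h, hleast⟩, left⟩
    exact ⟨h, (lplus_eq_dplus left).symm ▸ hleast⟩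

theorem isRightBandSemiring_iff :
    IsRightBandSemiring S ↔ IsBandSemiring S ∧ ∀ a b : S, a + b + a = b + a := by
  constructor
  · rintro ⟨h, hleast⟩
    have right : ∀ a b : S, a + b + a = b + a := fun a b => by
      have rel := (hleast.rel_add_comm a b).1
      rwa [← h.add_assoc, h.add_assoc a b b, h.add_self] at rel
    exact ⟨⟨h, rplus_eq_dplus right ▸ hleast⟩, right⟩
  · rintro ⟨⟨h, hleast⟩, right⟩
    exact ⟨h, (rplus_eq_dplus right).symm ▸ hleast⟩

theorem isLeftBandOrthoring_iff : IsLeftBandOrthoring S ↔ IsBandOrthoring S ∧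
    ∀ e ∈ addIdempotents S, ∀ f ∈ addIdempotents S, e + f + e = e + f := by
  constructor
  · rintro ⟨h, T, hT, hleft⟩
    obtain ⟨hband, left⟩ := isLeftBandSemiring_iff.1 hleft
    refine ⟨⟨h, T, hT, hband⟩, fun e he f hf => ?_⟩
    rw [← hT] at he hf
    exact congrArg Subtype.val (left ⟨e, he⟩ ⟨f, hf⟩)
  · rintro ⟨⟨h, T, hT, hband⟩, left⟩
    exact ⟨h, T, hT, isLeftBandSemiring_iff.2 ⟨hband, fun e f =>
      Subtype.ext (left e.1 (hT ▸ e.2) f.1 (hT ▸ f.2))⟩⟩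

theorem isRightBandOrthoring_iff : IsRightBandOrthoring S ↔ IsBandOrthoring S ∧
    ∀ e ∈ addIdempotents S, ∀ f ∈ addIdempotents S, e + f + e = f + e := by
  constructor
  · rintro ⟨h, T, hT, hright⟩
    obtain ⟨hband, right⟩ := isRightBandSemiring_iff.1 hright
    refine ⟨⟨h, T, hT, hband⟩, fun e he f hf => ?_⟩
    rw [← hT] at he hf
    exact congrArg Subtype.val (right ⟨e, he⟩ ⟨f, hf⟩)
  · rintro ⟨⟨h, T, hT, hband⟩, right⟩
    exact ⟨h, T, hT, isRightBandSemiring_iff.2 ⟨hband, fun e f =>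
      Subtype.ext (right e.1 (hT ▸ e.2) f.1 (hT ▸ f.2))⟩⟩

end BandSemiring

section CommutingInverse

variable {S : Type u}

/-- `x` is the inverse of `a` in a subgroup of the semigroup `(S, +)`. -/
structure IsCommutingInverse [Add S] (a x : S) : Prop where
  add_inv_add : a + x + a = a
  inv_add_inv : x + a + x = x
  comm : a + x = x + a

theorem IsCommutingInverse.unique [Add S] (assoc : ∀ x y z : S, (x + y) + z = x + (y + z))
    {a x y : S} (hx : IsCommutingInverse a x) (hy : IsCommutingInverse a y) : x = y := by
  have same_zero : a + x = a + y := by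
    calc a + x = a + y + a + x := by rw [hy.add_inv_add]
      _ = a + y + (a + x) := assoc _ _ _
      _ = y + a + (x + a) := by rw [hx.comm, hy.comm]
      _ = y + (a + x + a) := by simp only [assoc]
      _ = a + y := by rw [hx.add_inv_add, hy.comm]
  calc x = x + (a + x) := by rw [← assoc, hx.inv_add_inv]
    _ = x + a + y := by rw [same_zero, assoc]
    _ = y + a + y := by rw [← hx.comm, same_zero, hy.comm]
    _ = y := hy.inv_add_inv

variable [Add S] [Mul S]

theorem IsCommutingInverse.quotient {a x : S} (h : IsCommutingInverse a x) (c : RingCon S) :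
    IsCommutingInverse (a : c.Quotient) x :=
  ⟨congrArg _ h.add_inv_add, congrArg _ h.inv_add_inv, congrArg _ h.comm⟩

theorem IsCommutingInverse.mul_right (hS : IsSemiring S) {a x : S} (h : IsCommutingInverse a x)
    (b : S) : IsCommutingInverse (a * b) (x * b) :=
  ⟨by rw [← hS.right_distrib, ← hS.right_distrib, h.add_inv_add],
    by rw [← hS.right_distrib, ← hS.right_distrib, h.inv_add_inv],
    by rw [← hS.right_distrib, h.comm, hS.right_distrib]⟩

theorem IsCommutingInverse.mul_left (hS : IsSemiring S) {a x : S} (h : IsCommutingInverse a x)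
    (b : S) : IsCommutingInverse (b * a) (b * x) :=
  ⟨by rw [← hS.left_distrib, ← hS.left_distrib, h.add_inv_add],
    by rw [← hS.left_distrib, ← hS.left_distrib, h.inv_add_inv],
    by rw [← hS.left_distrib, h.comm, hS.left_distrib]⟩

/-- In a ring the commuting inverse is the negative, and `a + x` is the zero. -/
theorem IsRing.exists_isCommutingInverse {R : Type u} [Add R] [Mul R] (h : IsRing R) (a : R) :
    ∃ x, IsCommutingInverse a x ∧ a * (a + x) = a + x := by
  obtain ⟨z, zero_add, exists_neg⟩ := h.exists_zero_neg
  have eq_zero : ∀ e : R, e + e = e → e = z := fun e he => by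
    obtain ⟨y, hy⟩ := exists_neg e
    calc e = e + (e + y) := by rw [hy, h.add_comm, zero_add]
      _ = z := by rw [← h.add_assoc, he, hy]
  obtain ⟨x, hx⟩ := exists_neg a
  refine ⟨x, ⟨by rw [hx, zero_add], by rw [h.add_comm x, hx, zero_add], h.add_comm a x⟩, ?_⟩
  rw [hx]
  exact eq_zero _ (by rw [← h.left_distrib, zero_add])

theorem exists_isCommutingInverse_mem {R : Subsemiring S} (hR : IsRing R.Elem) {a : S}
    (ha : a ∈ R.carrier) : ∃ x ∈ R.carrier, IsCommutingInverse a x ∧ a * (a + x) = a + x := by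
  obtain ⟨⟨x, hx⟩, inv, mul_zero⟩ := hR.exists_isCommutingInverse ⟨a, ha⟩
  exact ⟨x, hx, ⟨congrArg Subtype.val inv.add_inv_add, congrArg Subtype.val inv.inv_add_inv,
    congrArg Subtype.val inv.comm⟩, congrArg Subtype.val mul_zero⟩

end CommutingInverse

section Idem

variable {S : Type u} [Add S] [Neg S]

/-- The identity element of the maximal subgroup of `(S, +)` containing `x`, usually written
`x⁰`. -/
def idem (x : S) : S := x + -x

namespace IsInverseOperation

theorem idem_add (hn : IsInverseOperation S) (x : S) : idem x + x = x := hn.add_neg_add x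

theorem idem_neg (hn : IsInverseOperation S) (x : S) : idem (-x) = idem x := by
  rw [idem, hn.neg_neg, idem, hn.add_neg_comm]

theorem isCommutingInverse_neg (hn : IsInverseOperation S) (x : S) :
    IsCommutingInverse x (-x) := by
  refine ⟨hn.add_neg_add x, ?_, hn.add_neg_comm x⟩
  have h := hn.add_neg_add (-x)
  rwa [hn.neg_neg] at h

end IsInverseOperation

variable [Mul S]

namespace IsSemiring

theorem add_idem (h : IsSemiring S) (hn : IsInverseOperation S) (x : S) : x + idem x = x := by
  rw [idem, hn.add_neg_comm, ← h.add_assoc, hn.add_neg_add]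

theorem idem_add_idem (h : IsSemiring S) (hn : IsInverseOperation S) (x : S) :
    idem x + idem x = idem x := by
  nth_rw 2 [idem]
  rw [← h.add_assoc, hn.idem_add, idem]

theorem neg_eq (h : IsSemiring S) (hn : IsInverseOperation S) {a x : S}
    (hx : IsCommutingInverse a x) : -a = x :=
  (hn.isCommutingInverse_neg a).unique h.add_assoc hx

theorem idem_eq_self (h : IsSemiring S) (hn : IsInverseOperation S) {e : S} (he : e + e = e) :
    idem e = e := by
  rw [idem, h.neg_eq hn ⟨by rw [he, he], by rw [he, he], rfl⟩, he]

theorem addIdempotents_eq_range_idem (h : IsSemiring S) (hn : IsInverseOperation S) :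
    addIdempotents S = Set.range idem := by
  refine Set.Subset.antisymm (fun e he => ⟨e, h.idem_eq_self hn he⟩) ?_
  rintro _ ⟨x, rfl⟩
  exact h.idem_add_idem hn x

theorem idem_mul (h : IsSemiring S) (hn : IsInverseOperation S) (x y : S) :
    idem (x * y) = idem x * y := by
  rw [idem, h.neg_eq hn ((hn.isCommutingInverse_neg x).mul_right h y), ← h.right_distrib, idem]

theorem idem_mul' (h : IsSemiring S) (hn : IsInverseOperation S) (x y : S) :
    idem (x * y) = x * idem y := by
  rw [idem, h.neg_eq hn ((hn.isCommutingInverse_neg y).mul_left h x), ← h.left_distrib, idem]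

theorem rel_neg_neg (h : IsSemiring S) (hn : IsInverseOperation S) {c : RingCon S} {a b : S}
    (hab : c a b) : c (-a) (-b) := by
  have inv_a := (hn.isCommutingInverse_neg a).quotient c
  rw [c.eq.2 hab] at inv_a
  exact c.eq.1 (inv_a.unique (h.quotient c).add_assoc ((hn.isCommutingInverse_neg b).quotient c))

end IsSemiring

end Idem

section Orthoring

variable {S : Type u} [Add S] [Mul S] [Neg S]

/-- The two-variable identities of band orthorings that suffice for the decomposition into a left
and a right component. Unlike the identities of `BandOrthoringLaws` they are visibly invariant
under reversing the addition. -/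
structure OrthoringLaws (S : Type u) [Add S] [Mul S] [Neg S] : Prop
    extends IsSemiring S, IsInverseOperation S where
  mul_idem_self : ∀ x : S, x * idem x = idem x
  add_self_idem : ∀ x y : S, idem x + idem y + (idem x + idem y) = idem x + idem y
  jle_mul_right_idem : ∀ x y : S, idem x + idem x * idem y + idem x = idem x
  jle_mul_left_idem : ∀ x y : S, idem x + idem y * idem x + idem x = idem x

namespace OrthoringLaws

theorem add_idem (h : OrthoringLaws S) (x : S) : x + idem x = x :=
  h.toIsSemiring.add_idem h.toIsInverseOperation x

theorem idem_add_idem (h : OrthoringLaws S) (x : S) : idem x + idem x = idem x :=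
  h.toIsSemiring.idem_add_idem h.toIsInverseOperation x

theorem idem_eq_self (h : OrthoringLaws S) {e : S} (he : e + e = e) : idem e = e :=
  h.toIsSemiring.idem_eq_self h.toIsInverseOperation he

theorem idem_idem (h : OrthoringLaws S) (x : S) : idem (idem x) = idem x :=
  h.idem_eq_self (h.idem_add_idem x)

theorem idem_mul (h : OrthoringLaws S) (x y : S) : idem (x * y) = idem x * y :=
  h.toIsSemiring.idem_mul h.toIsInverseOperation x y

theorem idem_mul' (h : OrthoringLaws S) (x y : S) : idem (x * y) = x * idem y :=
  h.toIsSemiring.idem_mul' h.toIsInverseOperation x y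

theorem mul_self (h : OrthoringLaws S) {e : S} (he : e + e = e) : e * e = e := by
  have law := h.mul_idem_self e
  rwa [h.idem_eq_self he] at law

theorem idem_mul_eq_idem_mul_idem (h : OrthoringLaws S) (x y : S) :
    idem (x * y) = idem x * idem y := by
  rw [← h.idem_mul', ← h.idem_idem (x * y), h.idem_mul x y]

/-- Expanding `idem (x + y) = (x + y) * idem (x + y)` shows that it depends only on `idem x` and
`idem y`. -/
theorem idem_add_eq (h : OrthoringLaws S) (x y : S) : idem (x + y) = idem x + idem y := by
  have replace : ∀ a b : S, idem a * b = idem a * idem b := fun a b => by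
    rw [← h.idem_mul, h.idem_mul_eq_idem_mul_idem]
  calc idem (x + y) = (x + y) * idem (x + y) := (h.mul_idem_self _).symm
    _ = idem x * (x + y) + idem y * (x + y) := by
      rw [h.right_distrib, ← h.idem_mul', ← h.idem_mul', h.idem_mul, h.idem_mul]
    _ = (idem x + idem y) * (idem x + idem y) := by
      rw [h.left_distrib, h.left_distrib, replace x x, replace x y, replace y x, replace y y,
        ← h.left_distrib, ← h.left_distrib, ← h.right_distrib]
    _ = idem x + idem y := h.mul_self (h.add_self_idem x y)

/-- The subsemiring `E⁺(S)`. -/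
def idempotents (h : OrthoringLaws S) : Subsemiring S where
  carrier := addIdempotents S
  add_mem x hx y hy := by
    have law := h.add_self_idem x y
    rwa [h.idem_eq_self hx, h.idem_eq_self hy] at law
  mul_mem x _ y hy := by
    change x * y + x * y = x * y
    rw [← h.left_distrib, show y + y = y from hy]

theorem bandSemiringLaws (h : OrthoringLaws S) : BandSemiringLaws h.idempotents.Elem where
  add_assoc x y z := Subtype.ext (h.add_assoc x.1 y.1 z.1)
  mul_assoc x y z := Subtype.ext (h.mul_assoc x.1 y.1 z.1)
  left_distrib x y z := Subtype.ext (h.left_distrib x.1 y.1 z.1)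
  right_distrib x y z := Subtype.ext (h.right_distrib x.1 y.1 z.1)
  add_self x := Subtype.ext x.2
  mul_self x := Subtype.ext (h.mul_self x.2)
  jle_mul_right x y := Subtype.ext (by
    have law := h.jle_mul_right_idem x.1 y.1
    rwa [h.idem_eq_self x.2, h.idem_eq_self y.2] at law)
  jle_mul_left x y := Subtype.ext (by
    have law := h.jle_mul_left_idem x.1 y.1
    rwa [h.idem_eq_self x.2, h.idem_eq_self y.2] at law)

/-- The idempotent `x⁰` as an element of `E⁺(S)`. -/
def idemElem (h : OrthoringLaws S) (x : S) : h.idempotents.Elem := ⟨idem x, h.idem_add_idem x⟩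

theorem idem_add_add_jle (h : OrthoringLaws S) (u x v : S) :
    JLe (idem (u + x + v)) (idem x) := by
  rw [h.idem_add_eq, h.idem_add_eq]
  exact congrArg Subtype.val (h.bandSemiringLaws.isAddBand.jle_of_eq_add_add
    (a := h.idemElem u + h.idemElem x + h.idemElem v) rfl)

theorem idem_add_eq_idem_add (h : OrthoringLaws S) {a b x : S} (hab : RPlus (idem a) (idem b))
    (hx : JLe (idem x) (idem a)) : idem a + x = idem b + x := by
  have hE : h.idemElem a + h.idemElem x = h.idemElem b + h.idemElem x :=
    h.bandSemiringLaws.add_eq_add_of_rplus ⟨Subtype.ext hab.1, Subtype.ext hab.2⟩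
      (Subtype.ext hx)
  calc idem a + x = idem a + idem x + x := by rw [h.add_assoc, h.idem_add]
    _ = idem b + idem x + x := congrArg (· + x) (congrArg Subtype.val hE)
    _ = idem b + x := by rw [h.add_assoc, h.idem_add]

end OrthoringLaws

/-- One half of the natural order `a = b + a⁰ = a⁰ + b` of the completely regular semigroup
`(S, +)`. On `E⁺(S)` it is the preorder of Green's relation `𝓡⁺`. -/
def RightNatLe (a b : S) : Prop := a = b + idem a

namespace OrthoringLaws

theorem rightNatLe_refl (h : OrthoringLaws S) (a : S) : RightNatLe a a := (h.add_idem a).symm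

theorem idem_add_idem_of_rightNatLe (h : OrthoringLaws S) {a b : S} (hab : RightNatLe a b) :
    idem b + idem a = idem a := by
  conv_rhs => rw [hab, h.idem_add_eq, h.idem_idem]

theorem rightNatLe_trans (h : OrthoringLaws S) {a b c : S} (hab : RightNatLe a b)
    (hbc : RightNatLe b c) : RightNatLe a c := by
  rw [RightNatLe, ← h.idem_add_idem_of_rightNatLe hab, ← h.add_assoc, ← hbc]
  exact hab

theorem rightNatLe_mul_left (h : OrthoringLaws S) {a b : S} (hab : RightNatLe a b) (c : S) :
    RightNatLe (c * a) (c * b) := by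
  rw [RightNatLe, h.idem_mul', ← h.left_distrib, ← hab]

theorem rightNatLe_mul_right (h : OrthoringLaws S) {a b : S} (hab : RightNatLe a b) (c : S) :
    RightNatLe (a * c) (b * c) := by
  rw [RightNatLe, h.idem_mul, ← h.right_distrib, ← hab]

theorem rightNatLe_add_left (h : OrthoringLaws S) {a b : S} (hab : RightNatLe a b) (c : S) :
    RightNatLe (c + a) (c + b) := by
  calc c + a = c + b + idem (c + b) + idem a := by rw [h.add_idem, h.add_assoc, ← hab]
    _ = c + b + idem (c + a) := by
      rw [h.idem_add_eq, h.idem_add_eq, h.add_assoc, h.add_assoc (idem c),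
        h.idem_add_idem_of_rightNatLe hab]

theorem rightNatLe_add_right (h : OrthoringLaws S) {a b : S} (hab : RightNatLe a b)
    (hba : RightNatLe b a) (c : S) : RightNatLe (a + c) (b + c) := by
  have rplus : RPlus (idem a) (idem b) :=
    ⟨h.idem_add_idem_of_rightNatLe hba, h.idem_add_idem_of_rightNatLe hab⟩
  have below : JLe (idem (c + (idem a + idem c))) (idem a) := by
    have jle := h.idem_add_add_jle c (idem a) (idem c)
    rwa [h.add_assoc, h.idem_idem] at jle
  have absorb : idem a + c + (idem a + idem c) = idem a + c := by
    have law := h.add_idem (idem a + c)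
    rwa [h.idem_add_eq, h.idem_idem] at law
  calc a + c = b + (idem a + c) := by rw [← h.add_assoc, ← hab]
    _ = b + (idem a + (c + (idem a + idem c))) := by rw [← h.add_assoc (idem a), absorb]
    _ = b + (idem b + (c + (idem a + idem c))) := by rw [h.idem_add_eq_idem_add rplus below]
    _ = b + c + idem (a + c) := by
      rw [← h.add_assoc, h.add_idem, ← h.add_assoc, h.idem_add_eq]

/-- The congruence whose quotient is the left component of a band orthoring; it restricts to `𝓡⁺`
on `E⁺(S)`. -/
def leftCon (h : OrthoringLaws S) : RingCon S where
  r a b := RightNatLe a b ∧ RightNatLe b a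
  iseqv := ⟨fun a => ⟨h.rightNatLe_refl a, h.rightNatLe_refl a⟩, And.symm,
    fun hab hbc => ⟨h.rightNatLe_trans hab.1 hbc.1, h.rightNatLe_trans hbc.2 hab.2⟩⟩
  add' {_ b c _} hab hcd :=
    ⟨h.rightNatLe_trans (h.rightNatLe_add_right hab.1 hab.2 c) (h.rightNatLe_add_left hcd.1 b),
      h.rightNatLe_trans (h.rightNatLe_add_left hcd.2 b) (h.rightNatLe_add_right hab.2 hab.1 c)⟩
  mul' {_ b c _} hab hcd :=
    ⟨h.rightNatLe_trans (h.rightNatLe_mul_right hab.1 c) (h.rightNatLe_mul_left hcd.1 b),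
      h.rightNatLe_trans (h.rightNatLe_mul_left hcd.2 b) (h.rightNatLe_mul_right hab.2 c)⟩

theorem leftCon_of_rplus (h : OrthoringLaws S) {e f : S} (hef : RPlus e f) : h.leftCon e f := by
  have idem_eq : ∀ {x y : S}, x + y = y → y + x = x → idem x = x := fun {x y} hxy hyx =>
    h.idem_eq_self (calc
      x + x = x + y + x := by rw [h.add_assoc, hyx]
      _ = x := by rw [hxy, hyx])
  constructor
  · rw [RightNatLe, idem_eq hef.1 hef.2, hef.2]
  · rw [RightNatLe, idem_eq hef.2 hef.1, hef.1]

theorem idem_op (h : OrthoringLaws S) (x : S) :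
    idem (AddOpposite.op x) = AddOpposite.op (idem x) := by
  rw [idem, idem, h.add_neg_comm]
  rfl

theorem addOpposite (h : OrthoringLaws S) : OrthoringLaws Sᵃᵒᵖ where
  add_assoc _ _ _ := AddOpposite.unop_injective (h.add_assoc _ _ _).symm
  mul_assoc _ _ _ := AddOpposite.unop_injective (h.mul_assoc _ _ _)
  left_distrib _ _ _ := AddOpposite.unop_injective (h.left_distrib _ _ _)
  right_distrib _ _ _ := AddOpposite.unop_injective (h.right_distrib _ _ _)
  add_neg_add x := AddOpposite.unop_injective
    ((h.add_assoc _ _ _).symm.trans (h.add_neg_add x.unop))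
  add_neg_comm x := AddOpposite.unop_injective (h.add_neg_comm x.unop).symm
  neg_neg x := AddOpposite.unop_injective (h.neg_neg x.unop)
  mul_idem_self := AddOpposite.rec' fun x => by
    rw [h.idem_op]
    exact AddOpposite.unop_injective (h.mul_idem_self x)
  add_self_idem := AddOpposite.rec' fun x => AddOpposite.rec' fun y => by
    rw [h.idem_op, h.idem_op]
    exact AddOpposite.unop_injective (h.add_self_idem y x)
  jle_mul_right_idem := AddOpposite.rec' fun x => AddOpposite.rec' fun y => by
    rw [h.idem_op, h.idem_op]
    exact AddOpposite.unop_injective ((h.add_assoc _ _ _).symm.trans (h.jle_mul_right_idem x y))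
  jle_mul_left_idem := AddOpposite.rec' fun x => AddOpposite.rec' fun y => by
    rw [h.idem_op, h.idem_op]
    exact AddOpposite.unop_injective ((h.add_assoc _ _ _).symm.trans (h.jle_mul_left_idem x y))

/-- The congruence whose quotient is the right component of a band orthoring; it restricts to `𝓛⁺`
on `E⁺(S)`. It is the left congruence of the semiring with reversed addition. -/
def rightCon (h : OrthoringLaws S) : RingCon S where
  r a b := h.addOpposite.leftCon (AddOpposite.op a) (AddOpposite.op b)
  iseqv := ⟨fun _ => RingCon.refl _ _, RingCon.symm _, RingCon.trans _⟩
  add' hab hcd := RingCon.add _ hcd hab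
  mul' hab hcd := RingCon.mul _ hab hcd

theorem rightCon_of_lplus (h : OrthoringLaws S) {e f : S} (hef : LPlus e f) : h.rightCon e f :=
  h.addOpposite.leftCon_of_rplus
    ⟨AddOpposite.unop_injective hef.2, AddOpposite.unop_injective hef.1⟩

theorem idem_add_idem_of_rightCon (h : OrthoringLaws S) {a b : S} (hab : h.rightCon a b) :
    idem b + idem a = idem b := by
  have hop := h.addOpposite.idem_add_idem_of_rightNatLe hab.2
  rw [h.idem_op, h.idem_op] at hop
  exact AddOpposite.op_injective hop

theorem eq_of_leftCon_of_rightCon (h : OrthoringLaws S) {a b : S} (hl : h.leftCon a b)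
    (hr : h.rightCon a b) : a = b := by
  have same_idem : idem a = idem b :=
    (h.idem_add_idem_of_rightNatLe hl.1).symm.trans (h.idem_add_idem_of_rightCon hr)
  calc a = b + idem a := hl.1
    _ = b := by rw [same_idem, h.add_idem]

theorem leftCon_idem_add_idem (h : OrthoringLaws S) (x y : S) :
    h.leftCon (idem x + idem y + idem x) (idem x + idem y) := by
  refine h.leftCon_of_rplus ⟨?_, ?_⟩
  · rw [h.add_assoc, ← h.add_assoc (idem x) (idem x), h.idem_add_idem, h.add_self_idem]
  · rw [← h.add_assoc, h.add_self_idem]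

theorem rightCon_idem_add_idem (h : OrthoringLaws S) (x y : S) :
    h.rightCon (idem x + idem y + idem x) (idem y + idem x) := by
  refine h.rightCon_of_lplus ⟨?_, ?_⟩
  · rw [h.add_assoc (idem x), h.add_assoc, h.add_self_idem]
  · rw [← h.add_assoc, ← h.add_assoc, h.add_assoc (idem y) (idem x) (idem x), h.idem_add_idem,
      h.add_assoc (idem y + idem x), h.add_self_idem]

end OrthoringLaws

end Orthoring

section BandOrthoring

variable {S : Type u} [Add S] [Mul S] [Neg S]

/-- The identities of band orthorings. The last one, with `s` and `t` ranging over all terms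
evaluated at the single element `x`, makes the subalgebra generated by `x` a ring: the maximal
additive subgroups need not be commutative. -/
structure BandOrthoringLaws (S : Type u) [Add S] [Mul S] [Neg S] : Prop
    extends OrthoringLaws S where
  eval_add_comm : ∀ (x : S) (s t : Term),
    s.eval (fun _ => x) + t.eval (fun _ => x) = t.eval (fun _ => x) + s.eval (fun _ => x)

/-- The subalgebra generated by one element. -/
def generatedBy (x : S) : Subsemiring S where
  carrier := Set.range fun t : Term => t.eval fun _ => x
  add_mem := by rintro _ ⟨s, rfl⟩ _ ⟨t, rfl⟩; exact ⟨.add s t, rfl⟩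
  mul_mem := by rintro _ ⟨s, rfl⟩ _ ⟨t, rfl⟩; exact ⟨.mul s t, rfl⟩

theorem OrthoringLaws.idem_eval (h : OrthoringLaws S) (x : S) (t : Term) :
    idem (t.eval fun _ => x) = idem x := by
  induction t with
  | var => rfl
  | add s t hs ht => rw [Term.eval, h.idem_add_eq, hs, ht, h.idem_add_idem]
  | mul s t hs ht =>
    rw [Term.eval, h.idem_mul_eq_idem_mul_idem, hs, ht, h.mul_self (h.idem_add_idem x)]
  | neg t ht => rw [Term.eval, h.idem_neg, ht]

theorem BandOrthoringLaws.isRing_generatedBy (h : BandOrthoringLaws S) (x : S) :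
    IsRing (generatedBy x).Elem where
  add_assoc a b c := Subtype.ext (h.add_assoc a.1 b.1 c.1)
  mul_assoc a b c := Subtype.ext (h.mul_assoc a.1 b.1 c.1)
  left_distrib a b c := Subtype.ext (h.left_distrib a.1 b.1 c.1)
  right_distrib a b c := Subtype.ext (h.right_distrib a.1 b.1 c.1)
  add_comm := by
    rintro ⟨_, s, rfl⟩ ⟨_, t, rfl⟩
    exact Subtype.ext (h.eval_add_comm x s t)
  exists_zero_neg := by
    refine ⟨⟨idem x, .add (.var 0) (.neg (.var 0)), rfl⟩, ?_, ?_⟩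
    · rintro ⟨_, t, rfl⟩
      refine Subtype.ext (?_ : idem x + t.eval _ = t.eval _)
      rw [← h.idem_eval x t, h.idem_add]
    · rintro ⟨_, t, rfl⟩
      exact ⟨⟨_, .neg t, rfl⟩, Subtype.ext (h.idem_eval x t)⟩

theorem BandOrthoringLaws.isBandOrthoring (h : BandOrthoringLaws S) : IsBandOrthoring S :=
  ⟨{ h with union_of_rings := fun x => ⟨generatedBy x, ⟨.var 0, rfl⟩, h.isRing_generatedBy x⟩ },
    h.idempotents, rfl, isBandSemiring_iff.2 h.bandSemiringLaws⟩

section Ring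

variable {R : Subsemiring S}

theorem neg_mem_of_isRing (h : IsSemiring S) (hn : IsInverseOperation S) (hR : IsRing R.Elem)
    {a : S} (ha : a ∈ R.carrier) : -a ∈ R.carrier := by
  obtain ⟨x, hx, inv, -⟩ := exists_isCommutingInverse_mem hR ha
  exact h.neg_eq hn inv ▸ hx

theorem eval_mem_of_isRing (h : IsSemiring S) (hn : IsInverseOperation S) (hR : IsRing R.Elem)
    {v : ℕ → S} (hv : ∀ n, v n ∈ R.carrier) (t : Term) : t.eval v ∈ R.carrier := by
  induction t with
  | var n => exact hv n
  | add s t hs ht => exact R.add_mem _ hs _ ht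
  | mul s t hs ht => exact R.mul_mem _ hs _ ht
  | neg t ht => exact neg_mem_of_isRing h hn hR ht

end Ring

namespace IsCompletelyRegular

theorem mul_idem_self (h : IsCompletelyRegular S) (hn : IsInverseOperation S) (x : S) :
    x * idem x = idem x := by
  obtain ⟨R, hx, hR⟩ := h.union_of_rings x
  obtain ⟨y, -, inv, mul_zero⟩ := exists_isCommutingInverse_mem hR hx
  rwa [idem, h.toIsSemiring.neg_eq hn inv]

theorem eval_add_comm (h : IsCompletelyRegular S) (hn : IsInverseOperation S) (x : S)
    (s t : Term) :
    s.eval (fun _ => x) + t.eval (fun _ => x) = t.eval (fun _ => x) + s.eval (fun _ => x) := by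
  obtain ⟨R, hx, hR⟩ := h.union_of_rings x
  have mem := eval_mem_of_isRing h.toIsSemiring hn hR fun _ => hx
  exact congrArg Subtype.val (hR.add_comm ⟨_, mem s⟩ ⟨_, mem t⟩)

end IsCompletelyRegular

theorem IsBandOrthoring.bandOrthoringLaws (h : IsBandOrthoring S) (hn : IsInverseOperation S) :
    BandOrthoringLaws S := by
  obtain ⟨h, T, hT, hband⟩ := h
  have hE := isBandSemiring_iff.1 hband
  have mem : ∀ x : S, idem x ∈ T.carrier := fun x =>
    hT ▸ h.toIsSemiring.idem_add_idem hn x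
  exact
    { h, hn with
      mul_idem_self := h.mul_idem_self hn
      add_self_idem := fun x y =>
        congrArg Subtype.val (hE.add_self (⟨idem x, mem x⟩ + ⟨idem y, mem y⟩))
      jle_mul_right_idem := fun x y =>
        congrArg Subtype.val (hE.jle_mul_right ⟨idem x, mem x⟩ ⟨idem y, mem y⟩)
      jle_mul_left_idem := fun x y =>
        congrArg Subtype.val (hE.jle_mul_left ⟨idem x, mem x⟩ ⟨idem y, mem y⟩)
      eval_add_comm := h.eval_add_comm hn }

theorem mem_BOR_iff {A : Alg.{u}} : A ∈ BOR ↔ BandOrthoringLaws A.carrier :=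
  ⟨fun h => h.1.bandOrthoringLaws h.2, fun h => ⟨h.isBandOrthoring, h.toIsInverseOperation⟩⟩

theorem mem_LBOR_iff {A : Alg.{u}} : A ∈ LBOR ↔
    A ∈ BOR ∧ ∀ x y : A.carrier, idem x + idem y + idem x = idem x + idem y := by
  refine (and_congr_left' isLeftBandOrthoring_iff).trans (and_right_comm.trans ?_)
  refine and_congr_right fun h => ?_
  rw [h.1.1.toIsSemiring.addIdempotents_eq_range_idem h.2, Set.forall_mem_range]
  simp only [Set.forall_mem_range]

theorem mem_RBOR_iff {A : Alg.{u}} : A ∈ RBOR ↔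
    A ∈ BOR ∧ ∀ x y : A.carrier, idem x + idem y + idem x = idem y + idem x := by
  refine (and_congr_left' isRightBandOrthoring_iff).trans (and_right_comm.trans ?_)
  refine and_congr_right fun h => ?_
  rw [h.1.1.toIsSemiring.addIdempotents_eq_range_idem h.2, Set.forall_mem_range]
  simp only [Set.forall_mem_range]

end BandOrthoring

section Variety

instance : Add Term := ⟨.add⟩

instance : Mul Term := ⟨.mul⟩

instance : Neg Term := ⟨.neg⟩

theorem Term.eval_add {S : Type u} [Add S] [Mul S] [Neg S] (v : ℕ → S) (s t : Term) :
    (s + t).eval v = s.eval v + t.eval v :=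
  rfl

/-- Evaluating a term in the algebra of terms is substitution. -/
theorem Term.eval_eval {S : Type u} [Add S] [Mul S] [Neg S] (v : ℕ → S) (w : ℕ → Term)
    (t : Term) : (t.eval w).eval v = t.eval fun n => (w n).eval v := by
  induction t with
  | var => rfl
  | add s t hs ht => exact congrArg₂ (· + ·) hs ht
  | mul s t hs ht => exact congrArg₂ (· * ·) hs ht
  | neg t ht => exact congrArg (- ·) ht

/-- The laws of `BandOrthoringLaws` as identities between terms; as `r`, `s`, `t` are arbitrary
terms, this set of identities is closed under substitution. -/
inductive BandOrthoringIdentity : Term → Term → Prop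
  | add_assoc (r s t : Term) : BandOrthoringIdentity (r + s + t) (r + (s + t))
  | mul_assoc (r s t : Term) : BandOrthoringIdentity (r * s * t) (r * (s * t))
  | left_distrib (r s t : Term) : BandOrthoringIdentity (r * (s + t)) (r * s + r * t)
  | right_distrib (r s t : Term) : BandOrthoringIdentity ((r + s) * t) (r * t + s * t)
  | add_neg_add (r : Term) : BandOrthoringIdentity (r + -r + r) r
  | add_neg_comm (r : Term) : BandOrthoringIdentity (r + -r) (-r + r)
  | neg_neg (r : Term) : BandOrthoringIdentity (- -r) r
  | mul_idem_self (r : Term) : BandOrthoringIdentity (r * idem r) (idem r)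
  | add_self_idem (r s : Term) :
    BandOrthoringIdentity (idem r + idem s + (idem r + idem s)) (idem r + idem s)
  | jle_mul_right_idem (r s : Term) :
    BandOrthoringIdentity (idem r + idem r * idem s + idem r) (idem r)
  | jle_mul_left_idem (r s : Term) :
    BandOrthoringIdentity (idem r + idem s * idem r + idem r) (idem r)
  | eval_add_comm (r s t : Term) :
    BandOrthoringIdentity (s.eval (fun _ => r) + t.eval (fun _ => r))
      (t.eval (fun _ => r) + s.eval (fun _ => r))

theorem BandOrthoringLaws.eval_eq {S : Type u} [Add S] [Mul S] [Neg S]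
    (h : BandOrthoringLaws S) (v : ℕ → S) {p q : Term} (hpq : BandOrthoringIdentity p q) :
    p.eval v = q.eval v := by
  cases hpq with
  | add_assoc => exact h.add_assoc _ _ _
  | mul_assoc => exact h.mul_assoc _ _ _
  | left_distrib => exact h.left_distrib _ _ _
  | right_distrib => exact h.right_distrib _ _ _
  | add_neg_add => exact h.add_neg_add _
  | add_neg_comm => exact h.add_neg_comm _
  | neg_neg => exact h.neg_neg _
  | mul_idem_self => exact h.mul_idem_self _
  | add_self_idem => exact h.add_self_idem _ _
  | jle_mul_right_idem => exact h.jle_mul_right_idem _ _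
  | jle_mul_left_idem => exact h.jle_mul_left_idem _ _
  | eval_add_comm r s t =>
    rw [Term.eval_add, Term.eval_add, Term.eval_eval, Term.eval_eval]
    exact h.eval_add_comm _ s t

/-- The assignment of `x`, `y`, `z` to the variables `0`, `1`, `2`. -/
def assign {S : Type u} (x y z : S) : ℕ → S
  | 0 => x
  | 1 => y
  | _ => z

theorem BandOrthoringLaws.of_eval_eq {S : Type u} [Add S] [Mul S] [Neg S]
    (h : ∀ {p q : Term}, BandOrthoringIdentity p q → ∀ v : ℕ → S, p.eval v = q.eval v) :
    BandOrthoringLaws S where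
  add_assoc x y z := h (.add_assoc (.var 0) (.var 1) (.var 2)) (assign x y z)
  mul_assoc x y z := h (.mul_assoc (.var 0) (.var 1) (.var 2)) (assign x y z)
  left_distrib x y z := h (.left_distrib (.var 0) (.var 1) (.var 2)) (assign x y z)
  right_distrib x y z := h (.right_distrib (.var 0) (.var 1) (.var 2)) (assign x y z)
  add_neg_add x := h (.add_neg_add (.var 0)) fun _ => x
  add_neg_comm x := h (.add_neg_comm (.var 0)) fun _ => x
  neg_neg x := h (.neg_neg (.var 0)) fun _ => x
  mul_idem_self x := h (.mul_idem_self (.var 0)) fun _ => x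
  add_self_idem x y := h (.add_self_idem (.var 0) (.var 1)) (assign x y y)
  jle_mul_right_idem x y := h (.jle_mul_right_idem (.var 0) (.var 1)) (assign x y y)
  jle_mul_left_idem x y := h (.jle_mul_left_idem (.var 0) (.var 1)) (assign x y y)
  eval_add_comm x s t := by
    have law := h (.eval_add_comm (.var 0) s t) fun _ => x
    rwa [Term.eval_add, Term.eval_add, Term.eval_eval, Term.eval_eval] at law

theorem isVariety_BOR : IsVariety BOR.{u} := by
  refine ⟨{p | BandOrthoringIdentity p.1 p.2}, Set.ext fun A => mem_BOR_iff.trans ?_⟩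
  exact ⟨fun h _ hp v => h.eval_eq v hp, fun h => .of_eval_eq fun hpq => h (_, _) hpq⟩

theorem IsVariety.inter {K L : Set Alg.{u}} (hK : IsVariety K) (hL : IsVariety L) :
    IsVariety (K ∩ L) := by
  obtain ⟨E, rfl⟩ := hK
  obtain ⟨F, rfl⟩ := hL
  exact ⟨E ∪ F, Set.ext fun A => by
    simp only [Set.mem_inter_iff, Set.mem_ofPred_eq, Set.mem_union, or_imp, forall_and]⟩

theorem isVariety_setOf_satisfies (p : Term × Term) : IsVariety {A : Alg.{u} | Satisfies A p} :=
  ⟨{p}, by simp only [Set.mem_singleton_iff, forall_eq]⟩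

theorem isVariety_LBOR : IsVariety LBOR.{u} := by
  convert isVariety_BOR.inter (isVariety_setOf_satisfies
    (idem (.var 0) + idem (.var 1) + idem (.var 0), idem (.var 0) + idem (.var 1))) using 1
  ext A
  exact mem_LBOR_iff.trans (and_congr_right' ⟨fun h v => h (v 0) (v 1), fun h x y =>
    h (assign x y y)⟩)

theorem isVariety_RBOR : IsVariety RBOR.{u} := by
  convert isVariety_BOR.inter (isVariety_setOf_satisfies
    (idem (.var 0) + idem (.var 1) + idem (.var 0), idem (.var 1) + idem (.var 0))) using 1
  ext A
  exact mem_RBOR_iff.trans (and_congr_right' ⟨fun h v => h (v 0) (v 1), fun h x y =>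
    h (assign x y y)⟩)

end Variety

section Quotient

variable {A : Alg.{u}} {c : RingCon A.carrier} {hc : ∀ a b, c a b → c (-a) (-b)}

/-- The quotient of an algebra by a congruence, that is, by a congruence of both binary operations
which also respects the unary one. -/
def Alg.quotient (A : Alg.{u}) (c : RingCon A.carrier) (hc : ∀ a b, c a b → c (-a) (-b)) :
    Alg.{u} where
  carrier := c.Quotient
  nonempty := ⟨(Classical.arbitrary A.carrier : A.carrier)⟩
  neg := ⟨Quotient.map' (fun a => -a) hc⟩

theorem eval_quotient (v : ℕ → A.carrier) (t : Term) :
    t.eval (S := (A.quotient c hc).carrier) (fun n => (v n : c.Quotient)) =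
      RingCon.toQuotient (c := c) (t.eval v) := by
  induction t with
  | var => rfl
  | add s t hs ht => exact congrArg₂ (· + ·) hs ht
  | mul s t hs ht => exact congrArg₂ (· * ·) hs ht
  | neg t ht => exact congrArg (- ·) ht

theorem satisfies_quotient_iff {p : Term × Term} :
    Satisfies (A.quotient c hc) p ↔ ∀ v : ℕ → A.carrier, c (p.1.eval v) (p.2.eval v) := by
  have eval_eq_iff : ∀ v : ℕ → A.carrier,
      p.1.eval (S := (A.quotient c hc).carrier) (fun n => (v n : c.Quotient)) =
        p.2.eval (S := (A.quotient c hc).carrier) (fun n => (v n : c.Quotient)) ↔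
      c (p.1.eval v) (p.2.eval v) := fun v => by
    rw [eval_quotient, eval_quotient]
    exact c.eq
  refine ⟨fun h v => (eval_eq_iff v).1 (h _), fun h w => ?_⟩
  obtain ⟨v, rfl⟩ : ∃ v : ℕ → A.carrier, w = fun n => (v n : c.Quotient) :=
    ⟨fun n => Quotient.out (w n), funext fun n => (Quotient.out_eq (w n)).symm⟩
  exact (eval_eq_iff v).2 (h v)

theorem IsVariety.quotient_mem {K : Set Alg.{u}} (hK : IsVariety K) (hA : A ∈ K) :
    A.quotient c hc ∈ K := by
  obtain ⟨E, rfl⟩ := hK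
  exact fun p hp => satisfies_quotient_iff.2 fun v => c.eq.1 (congrArg _ (hA p hp v))

end Quotient

section Join

variable {A : Alg.{u}}

namespace OrthoringLaws

/-- The left component of a band orthoring. -/
def leftQuotient (h : OrthoringLaws A.carrier) : Alg.{u} :=
  A.quotient h.leftCon fun _ _ => h.toIsSemiring.rel_neg_neg h.toIsInverseOperation

/-- The right component of a band orthoring. -/
def rightQuotient (h : OrthoringLaws A.carrier) : Alg.{u} :=
  A.quotient h.rightCon fun _ _ => h.toIsSemiring.rel_neg_neg h.toIsInverseOperation

theorem leftQuotient_mem_LBOR (h : OrthoringLaws A.carrier) (hA : A ∈ BOR) :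
    h.leftQuotient ∈ LBOR := by
  refine mem_LBOR_iff.2 ⟨isVariety_BOR.quotient_mem hA, ?_⟩
  rintro ⟨x⟩ ⟨y⟩
  exact h.leftCon.eq.2 (h.leftCon_idem_add_idem x y)

theorem rightQuotient_mem_RBOR (h : OrthoringLaws A.carrier) (hA : A ∈ BOR) :
    h.rightQuotient ∈ RBOR := by
  refine mem_RBOR_iff.2 ⟨isVariety_BOR.quotient_mem hA, ?_⟩
  rintro ⟨x⟩ ⟨y⟩
  exact h.rightCon.eq.2 (h.rightCon_idem_add_idem x y)

theorem satisfies_of_quotients (h : OrthoringLaws A.carrier) {p : Term × Term}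
    (hl : Satisfies h.leftQuotient p) (hr : Satisfies h.rightQuotient p) : Satisfies A p :=
  fun v => h.eq_of_leftCon_of_rightCon (satisfies_quotient_iff.1 hl v)
    (satisfies_quotient_iff.1 hr v)

end OrthoringLaws

theorem BOR_eq_varietyJoin : BOR.{u} = varietyJoin LBOR.{u} RBOR.{u} := by
  apply Set.Subset.antisymm
  · rintro A hA _ ⟨⟨E, rfl⟩, hL, hR⟩ p hp
    have h := (mem_BOR_iff.1 hA).toOrthoringLaws
    exact h.satisfies_of_quotients (hL (h.leftQuotient_mem_LBOR hA) p hp)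
      (hR (h.rightQuotient_mem_RBOR hA) p hp)
  · exact Set.sInter_subset_of_mem
      ⟨isVariety_BOR, fun _ hB => (mem_LBOR_iff.1 hB).1, fun _ hB => (mem_RBOR_iff.1 hB).1⟩

end Join

end BandOrthoring

theorem mainTheorem9 :
    BandOrthoring.IsVariety BandOrthoring.BOR.{u} ∧
    BandOrthoring.IsVariety BandOrthoring.LBOR.{u} ∧
    BandOrthoring.IsVariety BandOrthoring.RBOR.{u} ∧
    BandOrthoring.BOR.{u} =
      BandOrthoring.varietyJoin BandOrthoring.LBOR.{u} BandOrthoring.RBOR.{u} :=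
  ⟨BandOrthoring.isVariety_BOR, BandOrthoring.isVariety_LBOR, BandOrthoring.isVariety_RBOR,
    BandOrthoring.BOR_eq_varietyJoin⟩
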